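/- Let $G$ be a connected reductive linear algebraic group over $\mathbb{C}$, let $B \subseteq G$ be a Borel subgroup and $K \subseteq G$ a maximal compact subgroup, and let $H \subseteq G$ be a closed algebraic subgroup such that $G/H$ is quasi-affine and spherical, i.e. $B$ has a dense orbit in $G/H$. Let $G$ act on the ring $\mathbb{C}[G/H]$ of regular functions by $(g\cdot f)(x) = f(g^{-1}x)$. Write $\Lambda$ for the lattice of characters of $B$ (written additively), and $\Lambda^+_{G/H} \subseteq \Lambda$ for the set of highest weights of the finite-dimensional irreducible $G$-submodules of $\mathbb{C}[G/H]$. For $\lambda \in \Lambda^+_{G/H}$ let $V_\lambda \subseteq \mathbb{C}[G/H]$ be the $\lambda$-isotypic component (which is irreducible, since $G/H$ is spherical). Fix a $K$-invariant Hermitian inner product on $V_\lambda$ and an orthonormal basis $(f_{\lambda,i})_i$ of $V_\lambda$; the spherical function $\phi_\lambda : G/H \to \mathbb{R}$ is the positive multiple of $x \mapsto \sum_i |f_{\lambda,i}(x)|^2$ normalized by $\phi_\lambda(eH) = 1$. For $\lambda, \mu \in \Lambda^+_{G/H}$ let $\langle V_\lambda V_\mu\rangle \subseteq \mathbb{C}[G/H]$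 be the $\mathbb{C}$-span of all products $fg$ with $f \in V_\lambda$, $g \in V_\mu$; for $\gamma \in \Lambda$ we say that $V_\gamma$ appears in $\langle V_\lambda V_\mu\rangle$ if $\langle V_\lambda V_\mu\rangle$ contains an irreducible $G$-submodule with highest weight $\gamma$. (1) Let $\lambda, \mu, \gamma \in \Lambda^+_{G/H}$ and suppose that $V_\gamma$ appears in $\langle V_\lambda V_\mu \rangle$. Then there is a constant $c > 0$ such that $$\phi_\lambda(x)\,\phi_\mu(x) \ge c\,\phi_\gamma(x) \qquad \text{for all } x \in G/H.$$ (2) In particular, for all $\lambda, \mu \in \Lambda^+_{G/H}$ we have $\lambda + \mu \in \Lambda^+_{G/H}$, the module $V_{\lambda+\mu}$ appears in $\langle V_\lambda V_\mu\rangle$, and there is a constant $c > 0$ such that $\phi_\lambda(x)\,\phi_\mu(x) \ge c\,\phi_{\lambda+\mu}(x)$ for all $x \in G/H$. -/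

import Mathlib

open scoped MatrixGroups Topology

namespace SphericalSpace

noncomputable section

/-! ### Varieties as sets with an algebra of functions -/

section Zariski

variable {X : Type*}

/-- The Zariski topology on `X` determined by an algebra `A` of functions on `X`:
the sets `{f ≠ 0}`, `f ∈ A`, form a basis. -/
@[reducible] def zariski (A : Subalgebra ℂ (X → ℂ)) : TopologicalSpace X :=
  TopologicalSpace.generateFrom {U | ∃ f ∈ A, U = {x | f x ≠ 0}}

/-- The function `f` is regular on the Zariski open set `U`: near each point of `U` it is a
quotient of two elements of the coordinate ring `A`. -/
def IsRegularOn (A : Subalgebra ℂ (X → ℂ)) (U : Set X) (f : X → ℂ) : Prop :=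
  ∀ x ∈ U, ∃ p ∈ A, ∃ q ∈ A, q x ≠ 0 ∧ ∀ y ∈ U, q y ≠ 0 → f y = p y / q y

/-- The ring of functions on `X` that are polynomial in the coordinates of the points
`ι x ∈ ℂ^m`. -/
def polyFunctions {m : ℕ} (ι : X → (Fin m → ℂ)) : Subalgebra ℂ (X → ℂ) :=
  Algebra.adjoin ℂ (Set.range fun (i : Fin m) (x : X) => ι x i)

/-- The ring of functions on `X` that are polynomial in the entries of the matrices `ι x` and
`(ι x)⁻¹`. For the inclusion `ι` of a Zariski closed subset of `GL_n(ℂ)` this is the coordinate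
ring: `ℂ[GL_n]` is generated by the matrix entries and `1 / det`, that is, by the entries of
`g` and of `g⁻¹`. -/
def matrixFunctions {n : ℕ} (ι : X → GL (Fin n) ℂ) : Subalgebra ℂ (X → ℂ) :=
  Algebra.adjoin ℂ
    (Set.range (fun (p : Fin n × Fin n) (x : X) => (ι x : Matrix (Fin n) (Fin n) ℂ) p.1 p.2) ∪
      Set.range
        (fun (p : Fin n × Fin n) (x : X) => ((ι x)⁻¹ : GL (Fin n) ℂ).1 p.1 p.2))

end Zariski

section Group

variable {n : ℕ}

/-- `G ⊆ GL_n(ℂ)` is a linear algebraic group: it is Zariski closed. -/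
def IsAlgebraicGroup (G : Subgroup (GL (Fin n) ℂ)) : Prop :=
  IsClosed[zariski (matrixFunctions (id : GL (Fin n) ℂ → GL (Fin n) ℂ))] (G : Set (GL (Fin n) ℂ))

/-- The coordinate ring `ℂ[G]` of a linear algebraic group `G ⊆ GL_n(ℂ)`. -/
def coordRing (G : Subgroup (GL (Fin n) ℂ)) : Subalgebra ℂ (G → ℂ) :=
  matrixFunctions (Subtype.val : G → GL (Fin n) ℂ)

variable {G : Subgroup (GL (Fin n) ℂ)}

/-- A Zariski closed subset of `G`. -/
def IsZariskiClosed (Z : Set G) : Prop := IsClosed[zariski (coordRing G)] Z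

/-- A subset of `G` that is connected in the Zariski topology. -/
def IsZariskiConnected (Z : Set G) : Prop := @IsConnected G (zariski (coordRing G)) Z

variable (G) in
/-- The complex linear algebraic group `G` is reductive: it is the complexification of a compact
group, i.e. it has a subgroup that is compact in the Euclidean topology and Zariski dense. -/
def IsReductive : Prop :=
  ∃ C : Subgroup G, IsCompact (C : Set G) ∧ @Dense G (zariski (coordRing G)) (C : Set G)

/-- A Borel subgroup: maximal among the closed connected solvable subgroups. -/
def IsBorel (B : Subgroup G) : Prop :=
  Maximal (fun L : Subgroup G =>
    IsZariskiClosed (L : Set G) ∧ IsZariskiConnected (L : Set G) ∧ Group.IsSolvable L) B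

/-- A maximal compact subgroup (in the Euclidean topology). -/
def IsMaximalCompact (K : Subgroup G) : Prop :=
  Maximal (fun L : Subgroup G => IsCompact (L : Set G)) K

theorem translate_mem_coordRing (g : G) {f : G → ℂ} (hf : f ∈ coordRing G) :
    (fun x => f (g * x)) ∈ coordRing G := by
  unfold coordRing matrixFunctions at hf
  induction hf using Algebra.adjoin_induction with
  | mem f hf =>
    rcases hf with ⟨⟨i, j⟩, rfl⟩ | ⟨⟨i, j⟩, rfl⟩
    · have : (fun x : G => ((g * x : G) : GL (Fin n) ℂ).1 i j) =
          ∑ k, (g : GL (Fin n) ℂ).1 i k • (fun x : G => (x : GL (Fin n) ℂ).1 k j) := by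
        funext x
        simp [Matrix.mul_apply]
      change (fun x : G => ((g * x : G) : GL (Fin n) ℂ).1 i j) ∈ coordRing G
      rw [this]
      exact Subalgebra.sum_mem (coordRing G) fun k _ => Subalgebra.smul_mem (coordRing G)
        (Algebra.subset_adjoin (Or.inl ⟨(k, j), rfl⟩)) _
    · have : (fun x : G => (((g * x : G) : GL (Fin n) ℂ)⁻¹).1 i j) =
          ∑ k, ((g : GL (Fin n) ℂ)⁻¹).1 k j • (fun x : G => ((x : GL (Fin n) ℂ)⁻¹).1 i k) := by
        funext x
        rw [Subgroup.coe_mul, mul_inv_rev, Units.val_mul, Matrix.mul_apply]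
        simp [mul_comm]
      change (fun x : G => (((g * x : G) : GL (Fin n) ℂ)⁻¹).1 i j) ∈ coordRing G
      rw [this]
      exact Subalgebra.sum_mem (coordRing G) fun k _ => Subalgebra.smul_mem (coordRing G)
        (Algebra.subset_adjoin (Or.inr ⟨(i, k), rfl⟩)) _
  | algebraMap r => exact Subalgebra.algebraMap_mem _ r
  | add f f' _ _ h h' => exact Subalgebra.add_mem _ h h'
  | mul f f' _ _ h h' => exact Subalgebra.mul_mem _ h h'

theorem comp_inv_mem_coordRing {f : G → ℂ} (hf : f ∈ coordRing G) :
    (fun x => f x⁻¹) ∈ coordRing G := by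
  unfold coordRing matrixFunctions at hf
  induction hf using Algebra.adjoin_induction with
  | mem f hf =>
    rcases hf with ⟨⟨i, j⟩, rfl⟩ | ⟨⟨i, j⟩, rfl⟩
    · exact Algebra.subset_adjoin (Or.inr ⟨(i, j), rfl⟩)
    · refine Algebra.subset_adjoin (Or.inl ⟨(i, j), ?_⟩)
      funext x
      simp
  | algebraMap r => exact Subalgebra.algebraMap_mem _ r
  | add f f' _ _ h h' => exact Subalgebra.add_mem _ h h'
  | mul f f' _ _ h h' => exact Subalgebra.mul_mem _ h h'

/-- The lattice of weights of `B`: the characters `B → ℂˣ` that are regular functions on `B`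
(restrictions of elements of `ℂ[G]`), written additively. For a Borel subgroup, restriction
identifies it with the character lattice of any maximal torus of `B`. -/
def weightLattice (B : Subgroup G) : AddSubgroup (Additive (B →* ℂˣ)) where
  carrier := {χ | ∃ F ∈ coordRing G, ∀ b : B, ((χ.toMul b : ℂˣ) : ℂ) = F b}
  zero_mem' := ⟨1, Subalgebra.one_mem _, fun _ => by simp⟩
  add_mem' := by
    rintro χ ψ ⟨F, hF, h⟩ ⟨F', hF', h'⟩
    exact ⟨F * F', Subalgebra.mul_mem _ hF hF', fun b => by simp [h, h']⟩
  neg_mem' := by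
    rintro χ ⟨F, hF, h⟩
    refine ⟨_, comp_inv_mem_coordRing hF, fun b => ?_⟩
    have := h b⁻¹
    simpa using this

/-- The value `e^λ(b) ∈ ℂ` of a weight `λ` at `b ∈ B`. -/
def weightValue {B : Subgroup G} (lam : weightLattice B) (b : B) : ℂ :=
  ((lam : Additive (B →* ℂˣ)).toMul b : ℂˣ)

/-! ### The homogeneous space `G/H` -/

/-- The Zariski topology on `G/H`: the quotient topology. -/
@[reducible] def quotientZariski (H : Subgroup G) : TopologicalSpace (G ⧸ H) :=
  (zariski (coordRing G)).coinduced QuotientGroup.mk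

/-- `G/H` is quasi-affine: as a variety (its regular functions on an open set being the functions
that pull back to regular functions on `G`), it is isomorphic to a locally closed subvariety of
an affine space. -/
def IsQuasiAffine (H : Subgroup G) : Prop :=
  ∃ (m : ℕ) (X : Set (Fin m → ℂ)) (e : (G ⧸ H) ≃ X),
    @IsLocallyClosed _ (zariski (polyFunctions (id : (Fin m → ℂ) → (Fin m → ℂ)))) X ∧
    (∀ U : Set X, IsOpen[zariski (polyFunctions (Subtype.val : X → (Fin m → ℂ)))] U ↔
      IsOpen[quotientZariski H] (e ⁻¹' U)) ∧
    ∀ U : Set X, IsOpen[zariski (polyFunctions (Subtype.val : X → (Fin m → ℂ)))] U →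
      ∀ f : X → ℂ, (IsRegularOn (polyFunctions (Subtype.val : X → (Fin m → ℂ))) U f ↔
        IsRegularOn (coordRing G) {g : G | e (QuotientGroup.mk g) ∈ U}
          fun g => f (e (QuotientGroup.mk g)))

/-- `G/H` is spherical (with respect to the Borel subgroup `B` of `G`): some `B`-orbit is dense. -/
def IsSpherical (H B : Subgroup G) : Prop :=
  ∃ x : G ⧸ H, @Dense (G ⧸ H) (quotientZariski H) {y | ∃ b ∈ B, y = b • x}

/-- The ring `ℂ[G/H]` of regular functions on `G/H`: the functions whose pullback to `G` is
regular. -/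
def regularFunctions (H : Subgroup G) : Subalgebra ℂ (G ⧸ H → ℂ) where
  carrier := {f | (fun g : G => f (QuotientGroup.mk g)) ∈ coordRing G}
  mul_mem' h h' := Subalgebra.mul_mem (coordRing G) h h'
  add_mem' h h' := Subalgebra.add_mem (coordRing G) h h'
  algebraMap_mem' r := Subalgebra.algebraMap_mem (coordRing G) r

theorem translate_mem_regularFunctions {H : Subgroup G} (g : G) {f : G ⧸ H → ℂ}
    (hf : f ∈ regularFunctions H) : (fun x => f (g • x)) ∈ regularFunctions H :=
  translate_mem_coordRing (f := fun g' : G => f (QuotientGroup.mk g')) g hf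

/-- The natural action of `G` on `ℂ[G/H]`: `(g · f)(x) = f(g⁻¹x)`. -/
def translation (H : Subgroup G) : Representation ℂ G (regularFunctions H) where
  toFun g :=
    { toFun := fun f => ⟨fun x => f.1 (g⁻¹ • x),
        translate_mem_regularFunctions g⁻¹ f.2⟩
      map_add' := fun _ _ => rfl
      map_smul' := fun _ _ => rfl }
  map_one' := by ext f x; simp
  map_mul' g g' := by ext f x; simp [mul_smul]

/-! ### Highest weights and spherical functions -/

variable {H B : Subgroup G}

/-- `V ⊆ ℂ[G/H]` is a (finite-dimensional) irreducible `G`-module with highest weight `λ`: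
it contains a non-zero `B`-eigenvector of weight `λ`. -/
def IsIrreducibleOfHighestWeight (lam : weightLattice B)
    (V : Subrepresentation (translation H)) : Prop :=
  FiniteDimensional ℂ V.toSubmodule ∧ Representation.IsIrreducible (k := ℂ) (V := V.toSubmodule) V.toRepresentation ∧
    ∃ f ∈ V, f ≠ 0 ∧ ∀ b : B, translation H b f = weightValue lam b • f

/-- `V_λ` appears in the `G`-stable subspace `W` of `ℂ[G/H]`: the subspace `W` contains an
irreducible `G`-module of highest weight `λ`. -/
def Appears (lam : weightLattice B) (W : Submodule ℂ (regularFunctions H)) : Prop :=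
  ∃ V : Subrepresentation (translation H), IsIrreducibleOfHighestWeight lam V ∧ V.toSubmodule ≤ W

variable (H B) in
/-- The set `Λ⁺_{G/H}` of the highest weights that appear in `ℂ[G/H]`. -/
def highestWeights : Set (weightLattice B) :=
  {lam | Appears lam (⊤ : Submodule ℂ (regularFunctions H))}

variable (H) in
/-- The submodule `V_λ` of `ℂ[G/H]`: the `λ`-isotypic component, i.e. the sum of all irreducible
submodules with highest weight `λ` (for spherical `G/H` and `λ ∈ Λ⁺_{G/H}` there is just one). -/
def component (lam : weightLattice B) : Subrepresentation (translation H) where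
  toSubmodule := ⨆ (V : Subrepresentation (translation H))
    (_ : IsIrreducibleOfHighestWeight lam V), V.toSubmodule
  apply_mem_toSubmodule g := by
    suffices h : (⨆ (V : Subrepresentation (translation H))
        (_ : IsIrreducibleOfHighestWeight lam V), V.toSubmodule) ≤
        (⨆ (V : Subrepresentation (translation H))
          (_ : IsIrreducibleOfHighestWeight lam V), V.toSubmodule).comap (translation H g) from
      fun v hv => h hv
    refine iSup₂_le fun V hV v hv => ?_
    exact Submodule.mem_iSup_of_mem V
      (Submodule.mem_iSup_of_mem hV (V.apply_mem_toSubmodule g hv))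

/-- `φ` is the spherical function `φ_λ` on `G/H`: for a `K`-invariant Hermitian inner product on
`V_λ` and an orthonormal basis `f_1, …, f_m` of `V_λ`, it is a positive multiple of
`x ↦ ∑ |f_i(x)|²`, normalized by `φ(eH) = 1`. -/
def IsSphericalFunction (K : Subgroup G) (lam : weightLattice B) (φ : G ⧸ H → ℝ) : Prop :=
  ∃ (ip : InnerProductSpace.Core ℂ (component H lam).toSubmodule) (m : ℕ)
    (f : Module.Basis (Fin m) ℂ (component H lam).toSubmodule) (a : ℝ),
    (∀ k ∈ K, ∀ v w, ip.inner ((component H lam).toRepresentation k v)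
      ((component H lam).toRepresentation k w) = ip.inner v w) ∧
    (∀ i j, ip.inner (f i) (f j) = if i = j then 1 else 0) ∧
    0 < a ∧ (∀ x, φ x = a * ∑ i, ‖(f i).1.1 x‖ ^ 2) ∧
    φ (QuotientGroup.mk 1) = 1

end Group

end

end SphericalSpace

open SphericalSpace

/-!
Both parts rest on one estimate: if every element of an orthonormal basis of `V_γ` is a linear
combination of products of basis elements of `V_λ` and `V_μ`, then the Cauchy–Schwarz inequality
bounds `∑ |f_{γ,k}|²` by a constant times `(∑ |f_{λ,i}|²) (∑ |f_{μ,j}|²)`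
(`IsSphericalFunction.exists_mul_ge`). The hypothesis holds whenever `V_γ` appears in
`⟨V_λ V_μ⟩`, because `ℂ[G/H]` is multiplicity free: the quotient of two `B`-eigenfunctions of the
same weight is constant on the dense `B`-orbit, so irreducible submodules with the same highest
weight have a highest weight vector in common (`IsIrreducibleOfHighestWeight.component_eq`).

For the second part, the product of the highest weight vectors of `V_λ` and `V_μ` is a non-zero
`B`-eigenfunction of weight `λ + μ` in `⟨V_λ V_μ⟩`. Highest weight theory is not needed to place it
in an irreducible submodule: complete reducibility (`exists_complement`), proved by integrating
over a compact Zariski dense subgroup, and the uniqueness of eigenfunctions suffice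
(`appears_of_mem`).
-/

namespace SphericalSpace

open MeasureTheory ComplexConjugate

variable {n : ℕ} {G : Subgroup (GL (Fin n) ℂ)} {H B : Subgroup G}

/-! ### Regular functions: continuity, translates, vanishing on dense subsets -/

theorem right_translate_mem_coordRing (g : G) {f : G → ℂ} (hf : f ∈ coordRing G) :
    (fun x => f (x * g)) ∈ coordRing G := by
  simpa using comp_inv_mem_coordRing (translate_mem_coordRing g⁻¹ (comp_inv_mem_coordRing hf))

/-- Regular functions on `G` are continuous for the Euclidean topology. -/
theorem continuous_of_mem_coordRing {f : G → ℂ} (hf : f ∈ coordRing G) : Continuous f := by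
  unfold coordRing matrixFunctions at hf
  induction hf using Algebra.adjoin_induction with
  | mem f hf =>
    rcases hf with ⟨⟨i, j⟩, rfl⟩ | ⟨⟨i, j⟩, rfl⟩
    · exact (Units.continuous_val.comp continuous_subtype_val).matrix_elem i j
    · exact (Units.continuous_val.comp (continuous_inv.comp continuous_subtype_val)).matrix_elem i j
  | algebraMap r => exact continuous_const
  | add f f' _ _ h h' => exact h.add h'
  | mul f f' _ _ h h' => exact h.mul h'

theorem eq_zero_of_eqOn_dense {C : Set G} (hC : @Dense G (zariski (coordRing G)) C)
    {f : G → ℂ} (hf : f ∈ coordRing G) (h : ∀ c ∈ C, f c = 0) : f = 0 := by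
  let := zariski (coordRing G)
  by_contra hne
  obtain ⟨x, hx⟩ := Function.ne_iff.1 hne
  have hU : IsOpen {x | f x ≠ 0} := TopologicalSpace.isOpen_generateFrom_of_mem ⟨f, hf, rfl⟩
  obtain ⟨c, hc, hcC⟩ := hC.inter_open_nonempty _ hU ⟨x, hx⟩
  exact hc (h c hcC)

theorem regularFunctions_eq_zero_of_eqOn_dense {S : Set (G ⧸ H)}
    (hS : @Dense (G ⧸ H) (quotientZariski H) S) {f : regularFunctions H}
    (h : ∀ x ∈ S, f.1 x = 0) : f = 0 := by
  let := quotientZariski H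
  by_contra hne
  have hne' : f.1 ≠ 0 := fun h0 => hne (Subtype.ext h0)
  obtain ⟨x, hx⟩ := Function.ne_iff.1 hne'
  have hU : IsOpen {x | f.1 x ≠ 0} :=
    isOpen_coinduced.2 (TopologicalSpace.isOpen_generateFrom_of_mem
      ⟨fun g : G => f.1 (QuotientGroup.mk g), f.2, rfl⟩)
  obtain ⟨c, hc, hcC⟩ := hS.inter_open_nonempty _ hU ⟨x, hx⟩
  exact hc (h c hcC)

theorem translation_apply (g : G) (f : regularFunctions H) (x : G ⧸ H) :
    (translation H g f).1 x = f.1 (g⁻¹ • x) := rfl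

theorem translation_mul_apply (g : G) (f f' : regularFunctions H) :
    translation H g (f * f') = translation H g f * translation H g f' := rfl

theorem span_range_eq_top_of_separating {𝕜 V ι : Type*} [Field 𝕜] [AddCommGroup V] [Module 𝕜 V]
    [FiniteDimensional 𝕜 V] (e : ι → Module.Dual 𝕜 V) (he : ∀ v, (∀ i, e i v = 0) → v = 0) :
    Submodule.span 𝕜 (Set.range e) = ⊤ := by
  have h : (Submodule.span 𝕜 (Set.range e)).dualCoannihilator = ⊥ := by
    refine (Submodule.eq_bot_iff _).2 fun v hv => he v fun i => ?_
    exact (Submodule.mem_dualCoannihilator _).1 hv _ (Submodule.subset_span ⟨i, rfl⟩)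
  rw [← Subspace.dualCoannihilator_dualAnnihilator_eq (W := Submodule.span 𝕜 (Set.range e)), h,
    Submodule.dualAnnihilator_bot]

/-- The matrix coefficients of a finite-dimensional `G`-submodule of `ℂ[G/H]` are regular: it
suffices to check this for evaluations at points, since these span the dual space. -/
theorem matrixCoefficient_mem_coordRing (W : Subrepresentation (translation H))
    [FiniteDimensional ℂ W.toSubmodule] (l : Module.Dual ℂ W.toSubmodule) (w : W.toSubmodule) :
    (fun g => l (W.toRepresentation g w)) ∈ coordRing G := by
  let ev (x : G ⧸ H) : Module.Dual ℂ W.toSubmodule :=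
    LinearMap.proj x ∘ₗ (regularFunctions H).val.toLinearMap ∘ₗ W.toSubmodule.subtype
  have hspan : Submodule.span ℂ (Set.range ev) = ⊤ := by
    refine span_range_eq_top_of_separating (𝕜 := ℂ) (V := W.toSubmodule) ev fun v hv => ?_
    exact Subtype.ext (Subtype.ext (funext hv))
  have hl : l ∈ Submodule.span ℂ (Set.range ev) := hspan ▸ Submodule.mem_top
  induction hl using Submodule.span_induction with
  | mem l hl =>
    obtain ⟨x, rfl⟩ := hl
    obtain ⟨y, rfl⟩ := QuotientGroup.mk_surjective x
    exact comp_inv_mem_coordRing (right_translate_mem_coordRing y w.1.2)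
  | zero => exact Subalgebra.zero_mem _
  | add l l' _ _ h h' => exact Subalgebra.add_mem _ h h'
  | smul a l _ h => exact Subalgebra.smul_mem _ h a

/-! ### Complete reducibility by averaging over a compact subgroup -/

/-- The Hermitian form `∫_C \bar f f'` on `ℂ[G/H]`, for a compact Zariski dense subgroup `C` of
`G`. It is definite because a regular function vanishing on `C` vanishes on `G`. -/
theorem exists_invariant_innerProduct (C : Subgroup G) (hCc : IsCompact (C : Set G))
    (hCd : @Dense G (zariski (coordRing G)) (C : Set G)) :
    ∃ ip : InnerProductSpace.Core ℂ (regularFunctions H), ∀ c ∈ C, ∀ f f',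
      ip.inner (translation H c f) (translation H c f') = ip.inner f f' := by
  have : CompactSpace C := isCompact_iff_compactSpace.1 hCc
  let _ : MeasurableSpace C := borel C
  have : BorelSpace C := ⟨rfl⟩
  let ν : Measure C := Measure.haar
  let r (f : regularFunctions H) (c : C) : ℂ := f.1 (QuotientGroup.mk (c : G))
  have hr (f : regularFunctions H) : Continuous (r f) :=
    (continuous_of_mem_coordRing f.2).comp continuous_subtype_val
  have hint (f f' : regularFunctions H) : Integrable (fun c => conj (r f c) * r f' c) ν :=
    ((Complex.continuous_conj.comp (hr f)).mul (hr f')).integrable_of_hasCompactSupport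
      (HasCompactSupport.of_compactSpace _)
  have hsq (f : regularFunctions H) :
      ∫ c, conj (r f c) * r f c ∂ν = ((∫ c, ‖r f c‖ ^ 2 ∂ν : ℝ) : ℂ) := by
    rw [← integral_complex_ofReal]
    congr 1 with c
    rw [Complex.conj_mul']
    simp
  refine ⟨{ inner := fun f f' => ∫ c, conj (r f c) * r f' c ∂ν
            conj_inner_symm := fun f f' => ?_
            re_inner_nonneg := fun f => ?_
            add_left := fun f f' f'' => ?_
            smul_left := fun f f' a => ?_
            definite := fun f hf => ?_ }, fun c hc f f' => ?_⟩
  · rw [← integral_conj]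
    congr 1 with c
    simp [mul_comm]
  · rw [hsq]
    exact integral_nonneg fun c => by positivity
  · change ∫ c, conj (r f c + r f' c) * r f'' c ∂ν = _
    rw [← integral_add (hint f f'') (hint f' f'')]
    congr 1 with c
    rw [map_add, add_mul]
  · change ∫ c, conj (a * r f c) * r f' c ∂ν = _
    rw [← integral_const_mul]
    congr 1 with c
    rw [map_mul, mul_assoc]
  · change ∫ c, conj (r f c) * r f c ∂ν = 0 at hf
    have hzero : ∀ c ∈ C, f.1 (QuotientGroup.mk c) = 0 := by
      by_contra! hne
      obtain ⟨c, hc, hne⟩ := hne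
      rw [hsq, Complex.ofReal_eq_zero] at hf
      exact (((hr f).norm.pow 2).integral_pos_of_hasCompactSupport_nonneg_nonzero
        (HasCompactSupport.of_compactSpace _) (fun _ => sq_nonneg _)
        (x := ⟨c, hc⟩) (pow_ne_zero 2 (norm_ne_zero_iff.2 hne))).ne' hf
    have := eq_zero_of_eqOn_dense hCd f.2 hzero
    ext x
    obtain ⟨y, rfl⟩ := QuotientGroup.mk_surjective x
    exact congrFun this y
  · exact integral_mul_left_eq_self (fun d => conj (r f d) * r f' d) (⟨c, hc⟩⁻¹ : C)

/-- Orthogonal projection onto a finite-dimensional subspace, for an inner product that is not an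
instance on `V`. -/
theorem exists_mem_forall_inner_sub_eq_zero {V : Type*} [AddCommGroup V] [Module ℂ V]
    (ip : InnerProductSpace.Core ℂ V) (U : Submodule ℂ V) [FiniteDimensional ℂ U] (w : V) :
    ∃ u ∈ U, ∀ x ∈ U, ip.inner x (w - u) = 0 := by
  let _ : NormedAddCommGroup V := ip.toNormedAddCommGroup
  let _ : InnerProductSpace ℂ V := InnerProductSpace.ofCore ip.toCore
  exact ⟨U.starProjection w, U.starProjection_apply_mem w,
    fun x hx => Submodule.inner_right_of_mem_orthogonal hx (U.sub_starProjection_mem_orthogonal w)⟩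

/-- Every finite-dimensional submodule of `ℂ[G/H]` is completely reducible. The orthogonal
complement for a `C`-invariant inner product is `C`-stable; it is `G`-stable since matrix
coefficients are regular and `C` is Zariski dense. -/
theorem exists_complement (hG : IsReductive G) (W U : Subrepresentation (translation H))
    [FiniteDimensional ℂ W.toSubmodule] (hUW : U ≤ W) :
    ∃ U' : Subrepresentation (translation H), U' ≤ W ∧ Disjoint U.toSubmodule U'.toSubmodule ∧
      W.toSubmodule ≤ U.toSubmodule ⊔ U'.toSubmodule := by
  obtain ⟨C, hCc, hCd⟩ := hG
  obtain ⟨ip, hip⟩ := exists_invariant_innerProduct (H := H) C hCc hCd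
  let inn (u : regularFunctions H) : regularFunctions H →ₗ[ℂ] ℂ :=
    letI : NormedAddCommGroup (regularFunctions H) := ip.toNormedAddCommGroup
    letI : InnerProductSpace ℂ (regularFunctions H) := InnerProductSpace.ofCore ip.toCore
    innerₛₗ ℂ u
  have hUW' : U.toSubmodule ≤ W.toSubmodule := hUW
  let P : Submodule ℂ (regularFunctions H) :=
    { carrier := {w | w ∈ W.toSubmodule ∧ ∀ u ∈ U.toSubmodule, inn u w = 0}
      zero_mem' := ⟨zero_mem _, fun u _ => map_zero _⟩
      add_mem' := fun {a b} ha hb => ⟨add_mem ha.1 hb.1, fun u hu => by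
        rw [map_add, ha.2 u hu, hb.2 u hu, add_zero]⟩
      smul_mem' := fun a w hw => ⟨Submodule.smul_mem _ a hw.1, fun u hu => by
        rw [map_smul, hw.2 u hu, smul_zero]⟩ }
  refine ⟨⟨P, fun g w hw => ⟨W.apply_mem_toSubmodule g hw.1, fun u hu => ?_⟩⟩,
    fun w hw => hw.1, ?_, ?_⟩
  · have hmem := matrixCoefficient_mem_coordRing W (inn u ∘ₗ W.toSubmodule.subtype) ⟨w, hw.1⟩
    refine congrFun (eq_zero_of_eqOn_dense hCd hmem fun c hc => ?_) g
    change ip.inner u (translation H c w) = 0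
    rw [← hip c⁻¹ (inv_mem hc), ← Module.End.mul_apply, ← map_mul, inv_mul_cancel, map_one]
    exact hw.2 _ (U.apply_mem_toSubmodule c⁻¹ hu)
  · rw [Submodule.disjoint_def]
    exact fun u hu hu' => ip.definite u (hu'.2 u hu)
  · intro w hw
    have : FiniteDimensional ℂ U.toSubmodule := Submodule.finiteDimensional_of_le hUW'
    have hproj := exists_mem_forall_inner_sub_eq_zero ip U.toSubmodule w
    obtain ⟨u, hu, h⟩ := hproj
    exact Submodule.mem_sup.2 ⟨u, hu, w - u, ⟨sub_mem hw (hUW' hu), h⟩, add_sub_cancel u w⟩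

/-! ### Borel eigenfunctions on a spherical space -/

/-- No non-zero `B`-eigenfunction vanishes at a point of the dense `B`-orbit. -/
theorem IsSpherical.exists_point_ne_zero (hsph : IsSpherical H B) :
    ∃ x : G ⧸ H, ∀ (lam : weightLattice B) (f : regularFunctions H), f ≠ 0 →
      (∀ b : B, translation H b f = weightValue lam b • f) → f.1 x ≠ 0 := by
  obtain ⟨x, hx⟩ := hsph
  have hdense (f : regularFunctions H) (hf : ∀ b ∈ B, f.1 (b • x) = 0) : f = 0 :=
    regularFunctions_eq_zero_of_eqOn_dense hx fun y ⟨b, hb, hy⟩ => hy ▸ hf b hb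
  refine ⟨x, fun lam f hf0 hf h0 => hf0 (hdense f fun b hb => ?_)⟩
  have := congrFun (congrArg Subtype.val (hf (⟨b, hb⟩⁻¹ : B))) x
  change f.1 ((b⁻¹)⁻¹ • x) = weightValue lam _ * f.1 x at this
  rwa [inv_inv, h0, mul_zero] at this

/-- On a spherical space the eigenfunctions of a given weight form at most a line. -/
theorem IsSpherical.exists_eq_smul (hsph : IsSpherical H B) (lam : weightLattice B)
    {f f' : regularFunctions H} (hf0 : f ≠ 0)
    (hf : ∀ b : B, translation H b f = weightValue lam b • f)
    (hf' : ∀ b : B, translation H b f' = weightValue lam b • f') : ∃ a : ℂ, f' = a • f := by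
  obtain ⟨x, hx⟩ := hsph.exists_point_ne_zero
  have hfx := hx lam f hf0 hf
  refine ⟨f'.1 x / f.1 x, ?_⟩
  -- The difference is an eigenfunction of the same weight that vanishes at `x`.
  by_contra hne
  refine hx lam (f' - (f'.1 x / f.1 x) • f) (sub_ne_zero.2 hne) (fun b => ?_) ?_
  · rw [map_sub, map_smul, hf, hf', smul_sub, smul_comm]
  · change f'.1 x - f'.1 x / f.1 x * f.1 x = 0
    rw [div_mul_cancel₀ _ hfx, sub_self]

theorem IsIrreducibleOfHighestWeight.le_of_mem {lam : weightLattice B}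
    {V W : Subrepresentation (translation H)} (hV : IsIrreducibleOfHighestWeight lam V)
    {f : regularFunctions H} (hf0 : f ≠ 0) (hfV : f ∈ V) (hfW : f ∈ W) : V ≤ W := by
  have := hV.2.1
  let P : Subrepresentation V.toRepresentation :=
    ⟨W.toSubmodule.comap V.toSubmodule.subtype, fun g v hv => W.apply_mem_toSubmodule g hv⟩
  rcases eq_bot_or_eq_top P with h | h
  · have hmem : (⟨f, hfV⟩ : V.toSubmodule) ∈ P.toSubmodule := hfW
    rw [h] at hmem
    exact absurd (congrArg Subtype.val ((Submodule.mem_bot ℂ).1 hmem)) hf0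
  · intro v hv
    have hmem : (⟨v, hv⟩ : V.toSubmodule) ∈ P.toSubmodule := by rw [h]; exact Submodule.mem_top
    exact hmem

/-- `ℂ[G/H]` is multiplicity free for spherical `G/H`. -/
theorem IsIrreducibleOfHighestWeight.le (hsph : IsSpherical H B) {lam : weightLattice B}
    {V V' : Subrepresentation (translation H)} (hV : IsIrreducibleOfHighestWeight lam V)
    (hV' : IsIrreducibleOfHighestWeight lam V') : V ≤ V' := by
  obtain ⟨f, hfV, hf0, hf⟩ := hV.2.2
  obtain ⟨f', hfV', hf0', hf'⟩ := hV'.2.2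
  obtain ⟨a, rfl⟩ := hsph.exists_eq_smul lam hf0' hf' hf
  exact hV.le_of_mem hf0 hfV (Submodule.smul_mem V'.toSubmodule a hfV')

theorem IsIrreducibleOfHighestWeight.component_eq (hsph : IsSpherical H B) {lam : weightLattice B}
    {V : Subrepresentation (translation H)} (hV : IsIrreducibleOfHighestWeight lam V) :
    component H lam = V :=
  Subrepresentation.toSubmodule_injective <| le_antisymm
    (iSup₂_le fun _ hV' => hV'.le hsph hV)
    (le_iSup₂ (f := fun (V : Subrepresentation (translation H))
      (_ : IsIrreducibleOfHighestWeight lam V) => V.toSubmodule) V hV)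

theorem isIrreducible_component (hsph : IsSpherical H B) {lam : weightLattice B}
    (hlam : lam ∈ highestWeights H B) : IsIrreducibleOfHighestWeight lam (component H lam) := by
  obtain ⟨V, hV, -⟩ := hlam
  rwa [hV.component_eq hsph]

theorem Appears.component_le (hsph : IsSpherical H B) {lam : weightLattice B}
    {W : Submodule ℂ (regularFunctions H)} (h : Appears lam W) :
    (component H lam).toSubmodule ≤ W := by
  obtain ⟨V, hV, hVW⟩ := h
  rwa [hV.component_eq hsph]

/-- A submodule `W` of least dimension containing the eigenfunction `f` is irreducible: `f`
splits along `W = U ⊕ U'` into two eigenfunctions of the same weight, which are multiples of `f`,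
so that `f` lies in `U` or in `U'`. -/
theorem appears_of_mem (hG : IsReductive G) (hsph : IsSpherical H B) {lam : weightLattice B}
    (W : Subrepresentation (translation H)) [FiniteDimensional ℂ W.toSubmodule]
    {f : regularFunctions H} (hf0 : f ≠ 0) (hfW : f ∈ W)
    (hf : ∀ b : B, translation H b f = weightValue lam b • f) : Appears lam W.toSubmodule := by
  induction hd : Module.finrank ℂ W.toSubmodule using Nat.strong_induction_on generalizing W with
  | _ d ih =>
    by_cases hirr : Representation.IsIrreducible (k := ℂ) (V := W.toSubmodule) W.toRepresentation
    · exact ⟨W, ⟨inferInstance, hirr, f, hfW, hf0, hf⟩, le_rfl⟩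
    have hsmaller (U : Subrepresentation (translation H)) (hUW : U.toSubmodule < W.toSubmodule)
        (hfU : f ∈ U) : Appears lam W.toSubmodule := by
      have : FiniteDimensional ℂ U.toSubmodule := Submodule.finiteDimensional_of_le hUW.le
      obtain ⟨V, hV, hVU⟩ := ih _ (hd ▸ Submodule.finrank_lt_finrank_of_lt hUW) U hfU rfl
      exact ⟨V, hV, hVU.trans hUW.le⟩
    have : Nontrivial (Subrepresentation W.toRepresentation) := by
      refine ⟨⊥, ⊤, fun h => hf0 ?_⟩
      have hmem : (⟨f, hfW⟩ : W.toSubmodule) ∈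
        (⊤ : Subrepresentation W.toRepresentation).toSubmodule := Submodule.mem_top
      rw [← h] at hmem
      exact congrArg Subtype.val ((Submodule.mem_bot ℂ).1 hmem)
    obtain ⟨P, hPbot, hPtop⟩ : ∃ P : Subrepresentation W.toRepresentation, P ≠ ⊥ ∧ P ≠ ⊤ := by
      by_contra! h
      exact hirr ⟨fun P => or_iff_not_imp_left.2 (h P)⟩
    let U : Subrepresentation (translation H) :=
      ⟨P.toSubmodule.map W.toSubmodule.subtype, by
        rintro g _ ⟨w, hw, rfl⟩
        exact ⟨_, P.apply_mem_toSubmodule g hw, rfl⟩⟩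
    have hUW : U.toSubmodule ≤ W.toSubmodule := Submodule.map_subtype_le _ _
    have hUne : U.toSubmodule ≠ W.toSubmodule := fun h => hPtop <| by
      refine Subrepresentation.toSubmodule_injective
        (Submodule.map_injective_of_injective W.toSubmodule.injective_subtype ?_)
      exact h.trans (Submodule.map_subtype_top W.toSubmodule).symm
    have hUbot : U.toSubmodule ≠ ⊥ := fun h => hPbot <| by
      refine Subrepresentation.toSubmodule_injective
        (Submodule.map_injective_of_injective W.toSubmodule.injective_subtype ?_)
      exact h.trans (Submodule.map_bot W.toSubmodule.subtype).symm
    obtain ⟨U', hU'W, hdisj, hsup⟩ := exists_complement hG W U hUW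
    by_cases hfU' : f ∈ U'
    · refine hsmaller U' (lt_of_le_of_ne hU'W fun h => hUbot ?_) hfU'
      rw [h] at hdisj
      exact hdisj.eq_bot_of_le hUW
    obtain ⟨u, hu, u', hu', huf⟩ := Submodule.mem_sup.1 (hsup hfW)
    have heig (b : B) : translation H b u = weightValue lam b • u := by
      have h1 := hf b
      rw [← huf, map_add, smul_add] at h1
      have h2 : translation H b u - weightValue lam b • u =
          weightValue lam b • u' - translation H b u' := by
        rw [sub_eq_sub_iff_add_eq_add, h1, add_comm]
      refine sub_eq_zero.1 (Submodule.disjoint_def.1 hdisj _ ?_ ?_)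
      · exact sub_mem (U.apply_mem_toSubmodule _ hu) (Submodule.smul_mem _ _ hu)
      · rw [h2]
        exact sub_mem (Submodule.smul_mem _ _ hu') (U'.apply_mem_toSubmodule _ hu')
    have hu0 : u ≠ 0 := by
      rintro rfl
      rw [zero_add] at huf
      exact hfU' (huf ▸ hu')
    obtain ⟨a, ha⟩ := hsph.exists_eq_smul lam hu0 heig hf
    refine hsmaller U (lt_of_le_of_ne hUW hUne) ?_
    rw [ha]
    exact Submodule.smul_mem U.toSubmodule a hu

/-! ### Products of components -/

/-- The span of the products `f f'` with `f ∈ V`, `f' ∈ W`, as a `G`-submodule of `ℂ[G/H]`. -/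
def productSubrepresentation (V W : Subrepresentation (translation H)) :
    Subrepresentation (translation H) where
  toSubmodule := V.toSubmodule * W.toSubmodule
  apply_mem_toSubmodule g f hf := by
    induction hf using Submodule.mul_induction_on' with
    | mem_mul_mem v hv w hw =>
      rw [translation_mul_apply]
      exact Submodule.mul_mem_mul (V.apply_mem_toSubmodule g hv) (W.apply_mem_toSubmodule g hw)
    | add x _ y _ hx hy => rw [map_add]; exact add_mem hx hy

/-- The product of the highest weight vectors of `V_λ` and `V_μ` is an eigenfunction of weight
`λ + μ`; it is non-zero because neither factor vanishes at a point of the dense `B`-orbit. -/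
theorem appears_add (hG : IsReductive G) (hsph : IsSpherical H B) {lam mu : weightLattice B}
    (hlam : lam ∈ highestWeights H B) (hmu : mu ∈ highestWeights H B) :
    Appears (lam + mu) ((component H lam).toSubmodule * (component H mu).toSubmodule) := by
  obtain ⟨hfin, -, f, hfV, hf0, hf⟩ := isIrreducible_component hsph hlam
  obtain ⟨hfin', -, f', hfV', hf0', hf'⟩ := isIrreducible_component hsph hmu
  obtain ⟨x, hx⟩ := hsph.exists_point_ne_zero
  have : FiniteDimensional ℂ
      (productSubrepresentation (component H lam) (component H mu)).toSubmodule :=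
    Module.Finite.iff_fg.2 ((Module.Finite.iff_fg.1 hfin).mul (Module.Finite.iff_fg.1 hfin'))
  refine appears_of_mem hG hsph (productSubrepresentation (component H lam) (component H mu))
    (f := f * f') (fun h => ?_) (Submodule.mul_mem_mul hfV hfV') fun b => ?_
  · have h' : f.1 x * f'.1 x = 0 := congrFun (congrArg Subtype.val h) x
    exact mul_ne_zero (hx lam f hf0 hf) (hx mu f' hf0' hf') h'
  · have hval : weightValue (lam + mu) b = weightValue lam b * weightValue mu b := by
      simp [weightValue]
    rw [translation_mul_apply, hf, hf', hval, smul_mul_smul_comm]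

/-! ### Comparison of spherical functions -/

/-- A function in the span of the products `f_i f'_j` of two finite families satisfies
`|p|² ≤ c (∑ |f_i|²) (∑ |f'_j|²)`, by the Cauchy–Schwarz inequality. -/
theorem exists_norm_sq_le {U V : Submodule ℂ (regularFunctions H)} {m m' : ℕ}
    (f : Module.Basis (Fin m) ℂ U) (f' : Module.Basis (Fin m') ℂ V)
    {p : regularFunctions H} (hp : p ∈ U * V) :
    ∃ c : ℝ, 0 ≤ c ∧ ∀ x, ‖p.1 x‖ ^ 2 ≤
      c * ((∑ i, ‖(f i).1.1 x‖ ^ 2) * ∑ j, ‖(f' j).1.1 x‖ ^ 2) := by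
  have hexp (W : Submodule ℂ (regularFunctions H)) (k : ℕ) (e : Module.Basis (Fin k) ℂ W)
      (v : regularFunctions H) (hv : v ∈ W) :
      ∃ c : ℝ, 0 ≤ c ∧ ∀ x, ‖v.1 x‖ ^ 2 ≤ c * ∑ i, ‖(e i).1.1 x‖ ^ 2 := by
    refine ⟨∑ i, ‖e.repr ⟨v, hv⟩ i‖ ^ 2, by positivity, fun x => ?_⟩
    let ev : W →ₗ[ℂ] ℂ := LinearMap.proj x ∘ₗ (regularFunctions H).val.toLinearMap ∘ₗ W.subtype
    have h' : ∑ i, e.repr ⟨v, hv⟩ i * (e i).1.1 x = v.1 x := by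
      have h := congrArg ev (e.sum_repr ⟨v, hv⟩)
      rwa [map_sum, Finset.sum_congr rfl fun i _ => map_smul ev _ _] at h
    rw [← h']
    calc ‖∑ i, e.repr ⟨v, hv⟩ i * (e i).1.1 x‖ ^ 2
        ≤ (∑ i, ‖e.repr ⟨v, hv⟩ i‖ * ‖(e i).1.1 x‖) ^ 2 := by
          gcongr
          exact (norm_sum_le _ _).trans_eq (by simp only [norm_mul])
      _ ≤ _ := Finset.sum_mul_sq_le_sq_mul_sq _ _ _
  induction hp using Submodule.mul_induction_on' with
  | mem_mul_mem v hv w hw =>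
    obtain ⟨c, hc, h⟩ := hexp U m f v hv
    obtain ⟨c', hc', h'⟩ := hexp V m' f' w hw
    refine ⟨c * c', by positivity, fun x => ?_⟩
    calc ‖(v * w).1 x‖ ^ 2 = ‖v.1 x‖ ^ 2 * ‖w.1 x‖ ^ 2 := by
          change ‖v.1 x * w.1 x‖ ^ 2 = _
          rw [norm_mul, mul_pow]
      _ ≤ _ := mul_le_mul (h x) (h' x) (by positivity) (by positivity)
      _ = _ := by ring
  | add v _ w _ hv hw =>
    obtain ⟨c, hc, h⟩ := hv
    obtain ⟨c', hc', h'⟩ := hw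
    refine ⟨2 * (c + c'), by positivity, fun x => ?_⟩
    calc ‖(v + w).1 x‖ ^ 2 ≤ (‖v.1 x‖ + ‖w.1 x‖) ^ 2 := by
          gcongr
          exact norm_add_le (v.1 x) (w.1 x)
      _ ≤ 2 * (‖v.1 x‖ ^ 2 + ‖w.1 x‖ ^ 2) := add_sq_le
      _ ≤ _ := by linarith [h x, h' x]

theorem IsSphericalFunction.exists_mul_ge {K : Subgroup G} {lam mu gam : weightLattice B}
    (hle : (component H gam).toSubmodule ≤
      (component H lam).toSubmodule * (component H mu).toSubmodule)
    {φlam φmu φgam : G ⧸ H → ℝ} (hlam : IsSphericalFunction K lam φlam)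
    (hmu : IsSphericalFunction K mu φmu) (hgam : IsSphericalFunction K gam φgam) :
    ∃ c : ℝ, 0 < c ∧ ∀ x : G ⧸ H, φlam x * φmu x ≥ c * φgam x := by
  obtain ⟨-, m, f, a, -, -, ha, hf, -⟩ := hlam
  obtain ⟨-, m', f', a', -, -, ha', hf', -⟩ := hmu
  obtain ⟨-, m'', p, a'', -, -, ha'', hp, -⟩ := hgam
  choose c hc h using fun k => exists_norm_sq_le f f' (hle (p k).2)
  have hd : 0 < a'' * (∑ k, c k + 1) :=
    mul_pos ha'' (add_pos_of_nonneg_of_pos (Finset.sum_nonneg fun k _ => hc k) one_pos)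
  refine ⟨a * a' / (a'' * (∑ k, c k + 1)), by positivity, fun x => ?_⟩
  rw [ge_iff_le, div_mul_eq_mul_div, div_le_iff₀ hd, hf, hf', hp]
  set S := ∑ i, ‖(f i).1.1 x‖ ^ 2
  set S' := ∑ j, ‖(f' j).1.1 x‖ ^ 2
  have hS : 0 ≤ S * S' := by positivity
  have hsum : ∑ k, ‖(p k).1.1 x‖ ^ 2 ≤ (∑ k, c k + 1) * (S * S') := by
    calc ∑ k, ‖(p k).1.1 x‖ ^ 2 ≤ ∑ k, c k * (S * S') := Finset.sum_le_sum fun k _ => h k x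
      _ = (∑ k, c k) * (S * S') := (Finset.sum_mul ..).symm
      _ ≤ _ := by linarith
  calc a * a' * (a'' * ∑ k, ‖(p k).1.1 x‖ ^ 2)
      ≤ a * a' * (a'' * ((∑ k, c k + 1) * (S * S'))) := by gcongr
    _ = a * S * (a' * S') * (a'' * (∑ k, c k + 1)) := by ring

end SphericalSpace

theorem proposition2p9 {n : ℕ} (G : Subgroup (GL (Fin n) ℂ))
    (hG : IsAlgebraicGroup G) (hGconn : IsZariskiConnected (Set.univ : Set G))
    (hGred : IsReductive G)
    (H : Subgroup G) (hH : IsZariskiClosed (H : Set G))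
    (B : Subgroup G) (hB : IsBorel B)
    (hqa : IsQuasiAffine H) (hsph : IsSpherical H B)
    (K : Subgroup G) (hK : IsMaximalCompact K) :
    (∀ lam ∈ highestWeights H B, ∀ mu ∈ highestWeights H B, ∀ gam ∈ highestWeights H B,
      Appears gam ((component H lam).toSubmodule * (component H mu).toSubmodule) →
      ∀ φlam φmu φgam : G ⧸ H → ℝ, IsSphericalFunction K lam φlam →
        IsSphericalFunction K mu φmu → IsSphericalFunction K gam φgam →
        ∃ c : ℝ, 0 < c ∧ ∀ x : G ⧸ H, φlam x * φmu x ≥ c * φgam x) ∧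
    (∀ lam ∈ highestWeights H B, ∀ mu ∈ highestWeights H B,
      lam + mu ∈ highestWeights H B ∧
      Appears (lam + mu) ((component H lam).toSubmodule * (component H mu).toSubmodule) ∧
      ∀ φlam φmu φsum : G ⧸ H → ℝ, IsSphericalFunction K lam φlam →
        IsSphericalFunction K mu φmu → IsSphericalFunction K (lam + mu) φsum →
        ∃ c : ℝ, 0 < c ∧ ∀ x : G ⧸ H, φlam x * φmu x ≥ c * φsum x) := by
  refine ⟨fun lam _ mu _ gam _ happ φlam φmu φgam hlam hmu hgam =>
    hlam.exists_mul_ge (happ.component_le hsph) hmu hgam, fun lam hlam mu hmu => ?_⟩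
  have happ := appears_add hGred hsph hlam hmu
  refine ⟨?_, happ, fun φlam φmu φsum h h' h'' =>
    h.exists_mul_ge (happ.component_le hsph) h' h''⟩
  obtain ⟨V, hV, -⟩ := happ
  exact ⟨V, hV, le_top⟩
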